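/- A bigraph $F=(U_1,U_2,E)$ consists of finite sets $U_1,U_2$ and a set $E\subseteq U_1\times U_2$; write $|V|=|U_1|+|U_2|$ for its number of nodes. A graphon $(J,W)$ consists of a probability space $J$ with measure $\pi$ and a measurable symmetric function $W:J\times J\to[0,1]$. It excludes $F$ as an induced sub-bigraph if \[ \int_{J^{U_1}}\int_{J^{U_2}}\ \prod_{ij\in E}W(x_i,y_j)\prod_{ij\in (U_1\times U_2)\setminus E}\bigl(1-W(x_i,y_j)\bigr)\,dy\,dx=0 . \] For a finite partition $\mathcal P$ of $J$ into measurable sets of positive measure, let $W_{\mathcal P}(x,y)=\frac{1}{\pi(S(x))\pi(S(y))}\int_{S(x)\times S(y)}W\,d(\pi\times\pi)$, where $S(x)$ is the class of $\mathcal P$ containing $x$; $\mathcal P$ is an ultra-strong regularity partition of $(J,W)$ with error $\varepsilon$ if $\|W-W_{\mathcal P}\|_1=\int_{J\times J}|W-W_{\mathcal P}|\,d(\pi\times\pi)\le\varepsilon$. Theorem. For every bigraph $F=(U_1,U_2,E)$ there is a constant $c_F>0$, depending only on $F$, such that for every graphon $(J,W)$ that excludes $F$ as an induced sub-bigraph and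 every $0<\varepsilon<1$, $(J,W)$ has an ultra-strong regularity partition with error $\varepsilon$ into at most $c_F\,\varepsilon^{-10|V|^2}$ classes. -/

import Mathlib

open MeasureTheory

noncomputable section

/-- A bigraph `(U₁, U₂, E)` with node classes `U₁`, `U₂` and edge set `E ⊆ U₁ × U₂`. -/
structure Bigraph (U₁ U₂ : Type*) where
  edges : Set (U₁ × U₂)

/-- A bigraphon: a measurable function `J₁ × J₂ → [0,1]`. The probability measures on `J₁` and
`J₂` are passed as arguments wherever they are used. -/
structure Bigraphon (J₁ J₂ : Type*) [MeasurableSpace J₁] [MeasurableSpace J₂] where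
  toFun : J₁ → J₂ → ℝ
  measurable_uncurry : Measurable (Function.uncurry toFun)
  mem_Icc : ∀ x y, toFun x y ∈ Set.Icc (0 : ℝ) 1

/-- A graphon: a symmetric bigraphon with `J₁ = J₂`. -/
structure Graphon (J : Type*) [MeasurableSpace J] extends Bigraphon J J where
  symm : ∀ x y, toFun x y = toFun y x

namespace Bigraphon

variable {J₁ J₂ : Type*} [MeasurableSpace J₁] [MeasurableSpace J₂]

open Classical in
/-- `∏_{ij ∈ E} W(x_i, y_j) · ∏_{ij ∉ E} (1 - W(x_i, y_j))`. -/
def indWeight {U₁ U₂ : Type*} [Fintype U₁] [Fintype U₂] (W : Bigraphon J₁ J₂)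
    (F : Bigraph U₁ U₂) (x : U₁ → J₁) (y : U₂ → J₂) : ℝ :=
  (∏ e : U₁ × U₂ with e ∈ F.edges, W.toFun (x e.1) (y e.2)) *
    ∏ e : U₁ × U₂ with e ∉ F.edges, (1 - W.toFun (x e.1) (y e.2))

/-- The induced density of the bigraph `F` in the bigraphon `W`: the integral of `indWeight`
over independent choices of the points `x_i` (from `π₁`) and `y_j` (from `π₂`). -/
def indDensity {U₁ U₂ : Type*} [Fintype U₁] [Fintype U₂] (W : Bigraphon J₁ J₂)
    (π₁ : Measure J₁) (π₂ : Measure J₂) (F : Bigraph U₁ U₂) : ℝ :=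
  ∫ x : U₁ → J₁, ∫ y : U₂ → J₂, W.indWeight F x y
    ∂(Measure.pi fun _ => π₂) ∂(Measure.pi fun _ => π₁)

end Bigraphon

namespace Graphon

variable {J : Type*} [MeasurableSpace J]

/-- The graphon `W` excludes the bigraph `F` as an induced sub-bigraph: the induced density of
`F` in `W`, regarded as a bigraphon, is zero. -/
def ExcludesInduced {U₁ U₂ : Type*} [Fintype U₁] [Fintype U₂] (W : Graphon J)
    (π : Measure J) (F : Bigraph U₁ U₂) : Prop :=
  W.toBigraphon.indDensity π π F = 0

/-- `P` is a (finite) partition of `J` into measurable sets of positive measure. -/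
structure IsMeasurablePartition (π : Measure J) (P : Finset (Set J)) : Prop where
  isPartition : Setoid.IsPartition (P : Set (Set J))
  measurableSet : ∀ S ∈ P, MeasurableSet S
  measure_pos : ∀ S ∈ P, 0 < π S

/-- The class `S(x)` of the partition `P` that contains `x`. -/
def classOf (P : Finset (Set J)) (x : J) : Set J :=
  ⋃₀ {S : Set J | S ∈ P ∧ x ∈ S}

/-- The averaged function `W_P`: the mean of `W` over `S(x) × S(y)`. -/
def stepAverage (W : Graphon J) (π : Measure J) (P : Finset (Set J)) (x y : J) : ℝ :=
  (π.real (classOf P x) * π.real (classOf P y))⁻¹ *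
    ∫ z in classOf P x ×ˢ classOf P y, W.toFun z.1 z.2 ∂(π.prod π)

/-- `P` is an ultra-strong regularity partition of `W` with error `ε`: `‖W - W_P‖₁ ≤ ε`. -/
def IsUltraStrongPartition (W : Graphon J) (π : Measure J) (P : Finset (Set J)) (ε : ℝ) : Prop :=
  IsMeasurablePartition π P ∧
    ∫ z : J × J, |W.toFun z.1 z.2 - W.stepAverage π P z.1 z.2| ∂(π.prod π) ≤ ε

end Graphon

end

/-! Zero induced density has two pointwise consequences. First, `W` is almost everywhere 0 or 1: a
positive-measure set of fractional pairs would contain complete bipartite patterns with positive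
probability, and on those the weight of `F` is positive (`ae_ae_of_ae_ae_pi_exists`). Second, the
relation `1/2 < W` almost surely does not realise `F`, so its neighbourhoods behave like a family of
bounded VC dimension.

Let D = |V|. If m random points have neighbourhoods pairwise more than δ apart with positive
probability, then about 2 log m / δ random columns tell all m rows apart with positive probability.
Sauer–Shelah then produces `F` unless m ≤ D(t+1)^D, where t is the number of columns; this gives m =
O(δ^(-2D)) (`card_le_packingConst`). A separated family that almost no point can extend is a δ-net
(`exists_net`), and its cells become the classes.

Rows in one class are within 2δ in L¹. Replacing `W` by its block average costs the row variation
once per coordinate, hence 4δ in total (`integral_abs_sub_stepAverage_le`). With δ = ε/4 the class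
count is O(ε^(-2D)), stronger than required. -/

open MeasureTheory
open scoped ENNReal

/-! ### Patterns in 0–1 matrices with distinct rows -/

/-- Sauer–Shelah for matrices. -/
theorem exists_submatrix_of_card_lt {U₁ U₂ : Type*} [Fintype U₁] [Fintype U₂] (F : Bigraph U₁ U₂)
    {m t : ℕ} (b : Fin m → Fin t → Prop) (hb : Function.Injective b)
    (hm : (Fintype.card U₁ + Fintype.card U₂) * (t + 1) ^ (Fintype.card U₁ + Fintype.card U₂) < m) :
    ∃ f : U₁ → Fin m, ∃ g : U₂ → Fin t, Function.Injective f ∧ Function.Injective g ∧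
      ∀ i j, b (f i) (g j) ↔ (i, j) ∈ F.edges := by
  classical
  set D := Fintype.card U₁ + Fintype.card U₂ with hD
  let row : Fin m → Finset (Fin t) := fun a => Finset.univ.filter (b a)
  have hrow : Function.Injective row := by
    intro a a' h
    apply hb
    funext j
    have := congrArg (fun s => j ∈ s) h
    simpa [row] using this
  let A : Finset (Finset (Fin t)) := Finset.univ.image row
  have hA : A.card = m := by simp [A, Finset.card_image_of_injective _ hrow]
  have hvc : ∃ s, A.Shatters s ∧ D ≤ s.card := by
    by_contra! h
    have hsub : A.shatterer ⊆ (Finset.range D).biUnion fun k => Finset.univ.powersetCard k := by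
      intro s hs
      simpa using h s (Finset.mem_shatterer.1 hs)
    have h1 : A.shatterer.card ≤ D * (t + 1) ^ D := by
      refine (Finset.card_le_card hsub).trans ?_
      refine (Finset.card_biUnion_le_card_mul _ _ ((t + 1) ^ D) ?_).trans (by simp)
      intro k hk
      rw [Finset.card_powersetCard, Finset.card_univ, Fintype.card_fin]
      calc t.choose k ≤ t ^ k := Nat.choose_le_pow _ _
        _ ≤ (t + 1) ^ k := Nat.pow_le_pow_left (Nat.le_succ t) _
        _ ≤ (t + 1) ^ D := Nat.pow_le_pow_right (Nat.succ_pos t) (Finset.mem_range.1 hk).le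
    have := A.card_le_card_shatterer
    omega
  obtain ⟨s, hs, hcard⟩ := hvc
  -- Only the columns labelled by `U₂` carry `F`. Those labelled by `U₁` carry an identity matrix,
  -- whose sole purpose is to make the chosen rows distinct.
  obtain ⟨φ⟩ : Nonempty (U₁ ⊕ U₂ ↪ s) := by
    rw [Function.Embedding.nonempty_iff_card_le]
    simpa [hD] using hcard
  have hφ : ∀ p q, (φ p : Fin t) = φ q ↔ p = q := fun p q => by
    rw [Subtype.coe_inj, φ.injective.eq_iff]
  have key : ∀ i : U₁, ∃ a : Fin m, ∀ p : U₁ ⊕ U₂,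
      b a (φ p) ↔ Sum.elim (fun i' => i' = i) (fun j => (i, j) ∈ F.edges) p := by
    intro i
    let u : Finset (Fin t) := (Finset.univ.filter fun p : U₁ ⊕ U₂ =>
      Sum.elim (fun i' => i' = i) (fun j => (i, j) ∈ F.edges) p).image fun p => (φ p : Fin t)
    have hu : u ⊆ s := by
      intro z hz
      obtain ⟨p, -, rfl⟩ := Finset.mem_image.1 hz
      exact (φ p).2
    obtain ⟨v, hv, hvu⟩ := hs hu
    obtain ⟨a, -, rfl⟩ := Finset.mem_image.1 hv
    refine ⟨a, fun p => ?_⟩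
    have h1 : (φ p : Fin t) ∈ s ∩ row a ↔ (φ p : Fin t) ∈ u := by rw [hvu]
    have h2 : (φ p : Fin t) ∈ s ∩ row a ↔ b a (φ p) := by simp [row]
    rw [← h2, h1]
    simp only [u, Finset.mem_image, Finset.mem_filter, Finset.mem_univ, true_and, hφ]
    constructor
    · rintro ⟨q, hq, rfl⟩
      exact hq
    · exact fun h => ⟨p, h, rfl⟩
  choose f hf using key
  refine ⟨f, fun j => φ (Sum.inr j), ?_, ?_, fun i j => by simpa using hf i (Sum.inr j)⟩
  · intro i i' h
    have h1 := (hf i (Sum.inl i)).2 rfl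
    rw [h] at h1
    exact (hf i' (Sum.inl i)).1 h1
  · intro j j' h
    simpa using (hφ _ _).1 h

/-! ### Random columns separate distant rows -/

section Sampling

variable {J : Type*} [MeasurableSpace J] {π : Measure J} [IsProbabilityMeasure π]

theorem measurePreserving_comp_injective {ι κ : Type*} [Fintype ι] [Fintype κ] {f : ι → κ}
    (hf : Function.Injective f) :
    MeasurePreserving (fun x : κ → J => x ∘ f) (Measure.pi fun _ => π) (Measure.pi fun _ => π) := by
  refine ⟨by fun_prop, ?_⟩
  have h := (ProbabilityTheory.iIndepFun_pi (μ := fun _ : κ => π) (X := fun _ => id)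
    (fun _ => aemeasurable_id)).precomp hf
  have h2 := (ProbabilityTheory.iIndepFun_iff_map_fun_eq_pi_map (fun i => (measurable_pi_apply (f i)).aemeasurable)).1 h
  refine Eq.trans h2 ?_
  congr 1
  funext i
  exact (measurePreserving_eval (fun _ : κ => π) (f i)).map_eq

/-- The measure of the set where the `b`-neighbourhoods of `x` and `x'` differ. -/
noncomputable def nbhdDist (π : Measure J) (b : J → J → Prop) (x x' : J) : ℝ :=
  π.real {y | ¬ (b x y ↔ b x' y)}

/-- Union bound: two rows more than δ apart agree on t independent columns with probability at most
(1 - δ)^t, and there are at most m² pairs of rows. -/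
theorem not_ae_not_injective_rows {b : J → J → Prop} (hb : ∀ x, MeasurableSet {y | b x y})
    {m t : ℕ} {δ : ℝ} (x : Fin m → J)
    (hx : ∀ a a', a ≠ a' → δ < nbhdDist π b (x a) (x a')) (hδ : δ ≤ 1)
    (ht : (m : ℝ) ^ 2 * (1 - δ) ^ t < 1) :
    ¬ ∀ᵐ y : Fin t → J ∂(Measure.pi fun _ => π),
      ¬ Function.Injective fun a j => b (x a) (y j) := by
  classical
  intro h
  have hmeas : ∀ a a', MeasurableSet {y | b (x a) y ↔ b (x a') y} := fun a a' =>
    (hb (x a)).iff (hb (x a'))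
  let B : Fin m × Fin m → Set (Fin t → J) := fun p =>
    Set.univ.pi fun _ => {y | b (x p.1) y ↔ b (x p.2) y}
  have hB : ∀ p : Fin m × Fin m, p.1 ≠ p.2 →
      (Measure.pi fun _ => π).real (B p) ≤ (1 - δ) ^ t := by
    intro p hp
    have h1 : (Measure.pi fun _ : Fin t => π).real (B p)
        = (π.real {y | b (x p.1) y ↔ b (x p.2) y}) ^ t := by
      simp [B, Measure.real, Measure.pi_pi]
    rw [h1]
    refine pow_le_pow_left₀ measureReal_nonneg ?_ _
    have h2 := probReal_compl_eq_one_sub (μ := π) (hmeas p.1 p.2)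
    have h3 := hx p.1 p.2 hp
    rw [nbhdDist] at h3
    have h4 : {y | b (x p.1) y ↔ b (x p.2) y}ᶜ = {y | ¬ (b (x p.1) y ↔ b (x p.2) y)} := rfl
    rw [h4] at h2
    linarith
  let I : Finset (Fin m × Fin m) := Finset.univ.filter fun p => p.1 ≠ p.2
  have hcov : (Measure.pi fun _ : Fin t => π).real (⋃ p ∈ I, B p) = 1 := by
    have h1 : (⋃ p ∈ I, B p) =ᵐ[Measure.pi fun _ : Fin t => π] Set.univ := by
      rw [Filter.eventuallyEq_univ]
      filter_upwards [h] with y hy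
      simp only [Function.Injective, not_forall] at hy
      obtain ⟨a, a', haa, hne⟩ := hy
      refine Set.mem_biUnion (x := (a, a')) (by simpa [I] using hne) ?_
      exact fun j _ => iff_of_eq (congrFun haa j)
    rw [measureReal_congr h1, probReal_univ]
  have hle : (Measure.pi fun _ : Fin t => π).real (⋃ p ∈ I, B p) ≤ (m : ℝ) ^ 2 * (1 - δ) ^ t := by
    refine (measureReal_biUnion_finset_le _ _).trans ?_
    refine (Finset.sum_le_card_nsmul _ _ ((1 - δ) ^ t) fun p hp => hB p ?_).trans ?_
    · simpa [I] using hp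
    · rw [nsmul_eq_mul]
      refine mul_le_mul_of_nonneg_right ?_ (pow_nonneg (by linarith) _)
      have : I.card ≤ m ^ 2 := (Finset.card_le_univ _).trans (by simp [sq])
      exact_mod_cast this
  linarith

end Sampling

theorem nbhdDist_comm {J : Type*} [MeasurableSpace J] (π : Measure J) (b : J → J → Prop)
    (x x' : J) : nbhdDist π b x x' = nbhdDist π b x' x := by
  simp only [nbhdDist, iff_comm]

/-! ### Separated families and nets -/

section Packing

variable {J : Type*} [MeasurableSpace J] {π : Measure J} [IsProbabilityMeasure π]

theorem card_le_of_sample_size {U₁ U₂ : Type*} [Fintype U₁] [Fintype U₂] (F : Bigraph U₁ U₂)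
    {b : J → J → Prop} (hb : ∀ x, MeasurableSet {y | b x y})
    (hF : ∀ᵐ x : U₁ → J ∂(Measure.pi fun _ => π), ∀ᵐ y : U₂ → J ∂(Measure.pi fun _ => π),
      ¬ ∀ i j, b (x i) (y j) ↔ (i, j) ∈ F.edges)
    {m t : ℕ} {δ : ℝ} (hδ : δ ≤ 1) (ht : (m : ℝ) ^ 2 * (1 - δ) ^ t < 1)
    (hm : ¬ ∀ᵐ x : Fin m → J ∂(Measure.pi fun _ => π),
      ∃ a a', a ≠ a' ∧ nbhdDist π b (x a) (x a') ≤ δ) :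
    m ≤ (Fintype.card U₁ + Fintype.card U₂) * (t + 1) ^ (Fintype.card U₁ + Fintype.card U₂) := by
  by_contra! hlt
  have h1 : ∀ᵐ x : Fin m → J ∂(Measure.pi fun _ => π), ∀ f : U₁ → Fin m, Function.Injective f →
      ∀ᵐ y : U₂ → J ∂(Measure.pi fun _ => π),
        ¬ ∀ i j, b (x (f i)) (y j) ↔ (i, j) ∈ F.edges := by
    rw [ae_all_iff]
    intro f
    by_cases hf : Function.Injective f
    · filter_upwards [(measurePreserving_comp_injective (π := π) hf).quasiMeasurePreserving.ae hF]
        with x hx _ using hx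
    · exact Filter.Eventually.of_forall fun x h => absurd h hf
  apply hm
  filter_upwards [h1] with x hx
  by_contra! hsep
  refine not_ae_not_injective_rows hb x hsep hδ ht ?_
  have h2 : ∀ᵐ y : Fin t → J ∂(Measure.pi fun _ => π), ∀ f : U₁ → Fin m, Function.Injective f →
      ∀ g : U₂ → Fin t, Function.Injective g →
        ¬ ∀ i j, b (x (f i)) (y (g j)) ↔ (i, j) ∈ F.edges := by
    simp only [ae_all_iff]
    intro f hf g hg
    exact (measurePreserving_comp_injective (π := π) hg).quasiMeasurePreserving.ae (hx f hf)
  filter_upwards [h2] with y hy hinj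
  obtain ⟨f, g, hf, hg, hfg⟩ := exists_submatrix_of_card_lt F _ hinj hlt
  exact hy f hf g hg hfg

/-- The bound on the size of a separated family. -/
noncomputable def packingConst (D : ℕ) : ℝ := ((D : ℝ) * (4 * D + 2) ^ D) ^ 2

theorem card_le_packingConst {U₁ U₂ : Type*} [Fintype U₁] [Fintype U₂] (F : Bigraph U₁ U₂)
    {b : J → J → Prop} (hb : ∀ x, MeasurableSet {y | b x y})
    (hF : ∀ᵐ x : U₁ → J ∂(Measure.pi fun _ => π), ∀ᵐ y : U₂ → J ∂(Measure.pi fun _ => π),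
      ¬ ∀ i j, b (x i) (y j) ↔ (i, j) ∈ F.edges)
    {m : ℕ} {δ : ℝ} (hδ0 : 0 < δ) (hδ : δ ≤ 1)
    (hm : ¬ ∀ᵐ x : Fin m → J ∂(Measure.pi fun _ => π),
      ∃ a a', a ≠ a' ∧ nbhdDist π b (x a) (x a') ≤ δ) :
    (m : ℝ) ≤ packingConst (Fintype.card U₁ + Fintype.card U₂) *
      (δ⁻¹) ^ (2 * (Fintype.card U₁ + Fintype.card U₂)) := by
  rcases Nat.eq_zero_or_pos m with rfl | hm0
  · simp only [Nat.cast_zero, packingConst]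
    positivity
  set D := Fintype.card U₁ + Fintype.card U₂ with hD
  have hm1 : (1 : ℝ) ≤ m := by exact_mod_cast hm0
  set L := Real.log m with hL
  have hL0 : 0 ≤ L := Real.log_nonneg hm1
  -- This makes δt exceed 2 log m, so m²(1 - δ)^t ≤ exp(2 log m - δt) < 1.
  set t := ⌊2 * L / δ⌋₊ + 1 with ht
  have ht1 : 2 * L / δ < t := by
    rw [ht]; push_cast; exact Nat.lt_floor_add_one _
  have ht2 : (t : ℝ) ≤ 2 * L / δ + 1 := by
    rw [ht]; push_cast
    gcongr
    exact Nat.floor_le (by positivity)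
  have hexp : (m : ℝ) ^ 2 * (1 - δ) ^ t < 1 := by
    have h1 : (1 - δ) ^ t ≤ Real.exp (-(δ * t)) := by
      have := Real.add_one_le_exp (-δ)
      calc (1 - δ) ^ t ≤ (Real.exp (-δ)) ^ t :=
            pow_le_pow_left₀ (by linarith) (by linarith) _
        _ = Real.exp (-(δ * t)) := by rw [← Real.exp_nat_mul]; ring_nf
    have h2 : (m : ℝ) ^ 2 = Real.exp (2 * L) := by
      rw [two_mul, Real.exp_add, hL, Real.exp_log (by linarith), sq]
    calc (m : ℝ) ^ 2 * (1 - δ) ^ t ≤ Real.exp (2 * L) * Real.exp (-(δ * t)) := by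
          rw [h2]; gcongr
      _ = Real.exp (2 * L - δ * t) := by rw [← Real.exp_add]; ring_nf
      _ < 1 := by
          rw [Real.exp_lt_one_iff]
          rw [div_lt_iff₀ hδ0] at ht1
          linarith
  have hcard := card_le_of_sample_size F hb hF hδ hexp hm
  rw [← hD] at hcard
  have hcard' : (m : ℝ) ≤ D * ((t : ℝ) + 1) ^ D := by exact_mod_cast hcard
  have hDpos : 0 < D := by
    rcases Nat.eq_zero_or_pos D with h | h
    · rw [h] at hcard; omega
    · exact h
  have hDR : (0 : ℝ) < D := by exact_mod_cast hDpos
  -- The bound on m still involves log m through t. Since log m ≤ 2D·r, the D-th power of t + 1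
  -- costs only r^D, the square root of m, which can be cancelled.
  set r : ℝ := (m : ℝ) ^ (1 / (2 * D : ℝ)) with hr
  have hr1 : 1 ≤ r := Real.one_le_rpow hm1 (by positivity)
  have hLr : L ≤ 2 * D * r := by
    have := Real.log_le_rpow_div (x := (m : ℝ)) (by linarith) (ε := 1 / (2 * D : ℝ)) (by positivity)
    refine this.trans (le_of_eq ?_)
    rw [← hr]; field_simp
  have hrD : (r ^ D) ^ 2 = m := by
    rw [← pow_mul, hr, ← Real.rpow_natCast, ← Real.rpow_mul (by linarith)]
    push_cast
    rw [show 1 / (2 * D : ℝ) * (D * 2) = 1 by field_simp, Real.rpow_one]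
  have htr : (t : ℝ) + 1 ≤ (4 * D + 2) * r * δ⁻¹ := by
    have h1 : 1 ≤ r * δ⁻¹ := one_le_mul_of_one_le_of_one_le hr1 ((one_le_inv₀ hδ0).2 hδ)
    have h2 : 2 * L / δ ≤ 2 * (2 * D * r) * δ⁻¹ := by
      rw [div_eq_mul_inv]; gcongr
    nlinarith
  have hfin : (m : ℝ) ≤ (D * (4 * D + 2) ^ D * δ⁻¹ ^ D) * r ^ D := by
    calc (m : ℝ) ≤ D * ((t : ℝ) + 1) ^ D := hcard'
      _ ≤ D * ((4 * D + 2) * r * δ⁻¹) ^ D := by gcongr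
      _ = _ := by rw [mul_pow, mul_pow]; ring
  have hrpos : 0 < r ^ D := by positivity
  have h3 : r ^ D ≤ D * (4 * D + 2) ^ D * δ⁻¹ ^ D := by
    rw [← hrD, sq] at hfin
    exact le_of_mul_le_mul_right hfin hrpos
  calc (m : ℝ) = (r ^ D) ^ 2 := hrD.symm
    _ ≤ (D * (4 * D + 2) ^ D * δ⁻¹ ^ D) ^ 2 := by gcongr
    _ = _ := by rw [packingConst]; ring

/-- Maximality is taken in the almost-everywhere sense: m + 1 is the least length at which almost
every tuple has a close pair. Separated m-tuples then have positive measure, and by Fubini one of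
them has no separated extension outside a null set. -/
theorem exists_net {U₁ U₂ : Type*} [Fintype U₁] [Fintype U₂] (F : Bigraph U₁ U₂)
    {b : J → J → Prop} (hb : ∀ x, MeasurableSet {y | b x y})
    (hF : ∀ᵐ x : U₁ → J ∂(Measure.pi fun _ => π), ∀ᵐ y : U₂ → J ∂(Measure.pi fun _ => π),
      ¬ ∀ i j, b (x i) (y j) ↔ (i, j) ∈ F.edges)
    {δ : ℝ} (hδ0 : 0 < δ) (hδ : δ ≤ 1) :
    ∃ m : ℕ, (m : ℝ) ≤ packingConst (Fintype.card U₁ + Fintype.card U₂) *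
        (δ⁻¹) ^ (2 * (Fintype.card U₁ + Fintype.card U₂)) ∧
      ∃ x : Fin m → J, ∀ᵐ x' ∂π, ∃ a, nbhdDist π b x' (x a) ≤ δ := by
  classical
  let p : ℕ → Prop := fun n => ∀ᵐ x : Fin n → J ∂(Measure.pi fun _ => π),
      ∃ a a', a ≠ a' ∧ nbhdDist π b (x a) (x a') ≤ δ
  have hex : ∃ n, p n := by
    by_contra! h
    obtain ⟨n, hn⟩ := exists_nat_gt (packingConst (Fintype.card U₁ + Fintype.card U₂) *
        (δ⁻¹) ^ (2 * (Fintype.card U₁ + Fintype.card U₂)))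
    exact absurd (card_le_packingConst F hb hF hδ0 hδ (h n)) (not_le.2 hn)
  obtain ⟨n, hn, hmin⟩ : ∃ n, p n ∧ ∀ k < n, ¬ p k :=
    ⟨Nat.find hex, Nat.find_spec hex, fun k hk => Nat.find_min hex hk⟩
  cases n with
  -- The empty tuple has no pair of indices, so the least length is positive.
  | zero =>
    obtain ⟨x, a, -⟩ := hn.exists
    exact a.elim0
  | succ m =>
    have hm := hmin m (Nat.lt_succ_self m)
    refine ⟨m, card_le_packingConst F hb hF hδ0 hδ hm, ?_⟩
    -- Coordinate 0 is split off as the new point; the other m coordinates are the candidate net.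
    have h1 := ((measurePreserving_piFinSuccAbove (fun _ : Fin (m + 1) => π) 0).symm
      |>.quasiMeasurePreserving.ae hn)
    have h2 := Measure.ae_ae_of_ae_prod ((Measure.measurePreserving_swap
      (μ := Measure.pi fun _ : Fin m => π) (ν := π)).quasiMeasurePreserving.ae h1)
    obtain ⟨x, hsep, hx⟩ := ((Filter.not_eventually.1 hm).and_eventually h2).exists
    refine ⟨x, ?_⟩
    push Not at hsep
    filter_upwards [hx] with x' hx'
    obtain ⟨a, a', hne, hle⟩ := hx'
    simp only [MeasurableEquiv.piFinSuccAbove_symm_apply, Prod.swap, Fin.insertNthEquiv_apply,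
      Fin.insertNth_zero'] at hle
    induction a using Fin.cases with
    | zero =>
      induction a' using Fin.cases with
      | zero => exact absurd rfl hne
      | succ a' => exact ⟨a', by simpa using hle⟩
    | succ a =>
      induction a' using Fin.cases with
      | zero => exact ⟨a, by rw [nbhdDist_comm]; simpa using hle⟩
      | succ a' =>
        have := hsep a a' (fun h => hne (by rw [h]))
        simp only [Fin.cons_succ] at hle
        linarith

end Packing

/-! ### Pointwise consequences of zero induced density -/

namespace Bigraphon

variable {J₁ J₂ : Type*} [MeasurableSpace J₁] [MeasurableSpace J₂]
  {U₁ U₂ : Type*} [Fintype U₁] [Fintype U₂]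

theorem measurable_indWeight (W : Bigraphon J₁ J₂) (F : Bigraph U₁ U₂) :
    Measurable (Function.uncurry (W.indWeight F)) := by
  classical
  have h : ∀ e : U₁ × U₂, Measurable fun z : (U₁ → J₁) × (U₂ → J₂) =>
      W.toFun (z.1 e.1) (z.2 e.2) := fun e =>
    W.measurable_uncurry.comp (f := fun z : (U₁ → J₁) × (U₂ → J₂) => (z.1 e.1, z.2 e.2))
      (by fun_prop)
  unfold Function.uncurry indWeight
  exact (Finset.measurable_fun_prod _ fun e _ => h e).mul
    (Finset.measurable_fun_prod _ fun e _ => (h e).const_sub 1)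

theorem indWeight_nonneg (W : Bigraphon J₁ J₂) (F : Bigraph U₁ U₂) (x : U₁ → J₁) (y : U₂ → J₂) :
    0 ≤ W.indWeight F x y :=
  mul_nonneg (Finset.prod_nonneg fun _ _ => (W.mem_Icc _ _).1)
    (Finset.prod_nonneg fun _ _ => sub_nonneg.2 (W.mem_Icc _ _).2)

theorem indWeight_le_one (W : Bigraphon J₁ J₂) (F : Bigraph U₁ U₂) (x : U₁ → J₁) (y : U₂ → J₂) :
    W.indWeight F x y ≤ 1 := by
  refine mul_le_one₀ (Finset.prod_le_one (fun _ _ => (W.mem_Icc _ _).1) fun _ _ =>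
    (W.mem_Icc _ _).2) (Finset.prod_nonneg fun _ _ => sub_nonneg.2 (W.mem_Icc _ _).2)
    (Finset.prod_le_one (fun _ _ => sub_nonneg.2 (W.mem_Icc _ _).2) fun _ _ => ?_)
  linarith [(W.mem_Icc (x ‹U₁ × U₂›.1) (y ‹U₁ × U₂›.2)).1]

theorem indWeight_pos (W : Bigraphon J₁ J₂) (F : Bigraph U₁ U₂) (x : U₁ → J₁) (y : U₂ → J₂)
    (h1 : ∀ i j, (i, j) ∈ F.edges → 0 < W.toFun (x i) (y j))
    (h2 : ∀ i j, (i, j) ∉ F.edges → W.toFun (x i) (y j) < 1) : 0 < W.indWeight F x y := by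
  refine mul_pos (Finset.prod_pos fun e he => h1 _ _ ?_)
    (Finset.prod_pos fun e he => sub_pos.2 (h2 _ _ ?_)) <;> simpa using he

theorem ae_ae_indWeight_eq_zero (W : Bigraphon J₁ J₂) (F : Bigraph U₁ U₂) (π₁ : Measure J₁)
    (π₂ : Measure J₂) [IsProbabilityMeasure π₁] [IsProbabilityMeasure π₂]
    (h : W.indDensity π₁ π₂ F = 0) :
    ∀ᵐ x ∂(Measure.pi fun _ : U₁ => π₁), ∀ᵐ y ∂(Measure.pi fun _ : U₂ => π₂),
      W.indWeight F x y = 0 := by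
  have hm := W.measurable_indWeight F
  have hint : ∀ x, Integrable (fun y => W.indWeight F x y) (Measure.pi fun _ : U₂ => π₂) :=
    fun x => Integrable.of_bound (hm.of_uncurry_left (x := x)).aestronglyMeasurable 1
      (Filter.Eventually.of_forall fun y => by
        rw [Real.norm_of_nonneg (W.indWeight_nonneg F x y)]
        exact W.indWeight_le_one F x y)
  have hint2 : Integrable (fun x => ∫ y, W.indWeight F x y ∂(Measure.pi fun _ : U₂ => π₂))
      (Measure.pi fun _ : U₁ => π₁) := by
    refine Integrable.of_bound
      (hm.stronglyMeasurable.integral_prod_right).aestronglyMeasurable 1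
      (Filter.Eventually.of_forall fun x => ?_)
    rw [Real.norm_of_nonneg (integral_nonneg fun y => W.indWeight_nonneg F x y)]
    refine (integral_mono (hint x) (integrable_const 1) fun y => W.indWeight_le_one F x y).trans ?_
    simp
  rw [indDensity, integral_eq_zero_iff_of_nonneg
    (fun x => integral_nonneg fun y => W.indWeight_nonneg F x y) hint2] at h
  filter_upwards [h] with x hx
  exact (integral_eq_zero_iff_of_nonneg (fun y => W.indWeight_nonneg F x y) (hint x)).1 hx

end Bigraphon

/-- The tuples all of whose entries violate `p` form a power of the exceptional set, and a product
of measures vanishes only if a factor does. For empty `ι` the product is 1, so the hypothesis is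
contradictory. -/
theorem ae_of_ae_pi_exists {ι J : Type*} [Fintype ι] [MeasurableSpace J] {π : Measure J}
    [IsProbabilityMeasure π] {p : J → Prop}
    (h : ∀ᵐ x ∂(Measure.pi fun _ : ι => π), ∃ i, p (x i)) : ∀ᵐ x ∂π, p x := by
  have h1 : (Measure.pi fun _ : ι => π) (Set.univ.pi fun _ => {x | ¬ p x}) = 0 := by
    rw [← nonpos_iff_eq_zero, ← (ae_iff.1 h)]
    refine measure_mono fun x hx => ?_
    simpa [Set.mem_pi] using hx
  rw [Measure.pi_pi, Finset.prod_eq_zero_iff] at h1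
  obtain ⟨i, -, hi⟩ := h1
  exact ae_iff.2 hi

/-- If a.e. complete bipartite pattern contains a pair satisfying `p`, then a.e. pair does. -/
theorem ae_ae_of_ae_ae_pi_exists {J₁ J₂ U₁ U₂ : Type*} [MeasurableSpace J₁] [MeasurableSpace J₂]
    [Fintype U₁] [Fintype U₂] {π₁ : Measure J₁} {π₂ : Measure J₂} [IsProbabilityMeasure π₁]
    [IsProbabilityMeasure π₂] {p : J₁ → J₂ → Prop} (hp : MeasurableSet {z : J₁ × J₂ | p z.1 z.2})
    (h : ∀ᵐ x ∂(Measure.pi fun _ : U₁ => π₁), ∀ᵐ y ∂(Measure.pi fun _ : U₂ => π₂),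
      ∃ i j, p (x i) (y j)) :
    ∀ᵐ x ∂π₁, ∀ᵐ y ∂π₂, p x y := by
  have h1 : ∀ᵐ x ∂(Measure.pi fun _ : U₁ => π₁), ∀ᵐ y ∂π₂, ∃ i, p (x i) y := by
    filter_upwards [h] with x hx
    refine ae_of_ae_pi_exists (ι := U₂) (p := fun y => ∃ i, p (x i) y) ?_
    filter_upwards [hx] with y ⟨i, j, hij⟩ using ⟨j, i, hij⟩
  have hm : MeasurableSet {z : (U₁ → J₁) × J₂ | ∃ i, p (z.1 i) z.2} := by
    simp only [Set.ofPred_exists]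
    refine MeasurableSet.iUnion fun i => ?_
    exact hp.preimage (f := fun z : (U₁ → J₁) × J₂ => (z.1 i, z.2)) (by fun_prop)
  -- The `y`-tuple has been reduced to one point for fixed `x`; exchanging quantifiers allows the
  -- same reduction for the `x`-tuple.
  rw [Measure.ae_ae_comm hm] at h1
  rw [Measure.ae_ae_comm hp]
  filter_upwards [h1] with y hy using ae_of_ae_pi_exists (p := fun x => p x y) hy

/-! ### From an almost-everywhere cover to a partition -/

section Partition

variable {J : Type*} [MeasurableSpace J] {π : Measure J} [IsProbabilityMeasure π]

theorem exists_partition_of_ae_cover {m : ℕ} (C : Fin m → Set J) (hC : ∀ a, MeasurableSet (C a))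
    (hcov : ∀ᵐ x ∂π, ∃ a, x ∈ C a) :
    ∃ P : Finset (Set J), Graphon.IsMeasurablePartition π P ∧ P.card ≤ m ∧
      ∀ S ∈ P, ∃ a, ∀ᵐ x ∂π, x ∈ S → x ∈ C a := by
  classical
  let E : Fin m → Set J := disjointed C
  have hE : ∀ a, MeasurableSet (E a) := fun a => by
    exact disjointedRec (p := MeasurableSet) (fun _ _ h => h.diff (hC _)) (hC a)
  have hdisj : Pairwise (Function.onFun Disjoint E) := disjoint_disjointed C
  let I : Finset (Fin m) := Finset.univ.filter fun a => π (E a) ≠ 0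
  let N : Set J := (⋃ a ∈ I, E a)ᶜ
  have hN : ∀ᵐ x ∂π, x ∉ N := by
    have h1 : ∀ᵐ x ∂π, ∀ a, a ∉ I → x ∉ E a := by
      rw [ae_all_iff]
      intro a
      by_cases ha : a ∈ I
      · exact Filter.Eventually.of_forall fun x h => absurd ha h
      · have : π (E a) = 0 := by simpa [I] using ha
        filter_upwards [measure_eq_zero_iff_ae_notMem.1 this] with x hx _ using hx
    filter_upwards [hcov, h1] with x hx h1x
    have hx' : x ∈ ⋃ a, E a := by
      rw [show (⋃ a, E a) = ⋃ a, C a from iSup_disjointed C]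
      exact Set.mem_iUnion.2 hx
    obtain ⟨a, ha⟩ := Set.mem_iUnion.1 hx'
    simp only [N, Set.notMem_compl_iff]
    refine Set.mem_biUnion (x := a) ?_ ha
    by_contra h
    exact h1x a h ha
  obtain ⟨a₀, ha₀⟩ : I.Nonempty := by
    obtain ⟨x, hx⟩ := hN.exists
    simp only [N, Set.notMem_compl_iff, Set.mem_iUnion] at hx
    obtain ⟨a, ha, -⟩ := hx
    exact ⟨a, ha⟩
  have hNm : MeasurableSet N := (Finset.measurableSet_biUnion _ fun a _ => hE a).compl
  -- The null remainder `N`, which includes the discarded null cells, is attached to one cell: the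
  -- classes must cover all of `J` and each have positive measure.
  let S : Fin m → Set J := fun a => E a ∪ if a = a₀ then N else ∅
  have hS : ∀ a x, x ∈ S a ↔ x ∈ E a ∨ (a = a₀ ∧ x ∈ N) := by
    intro a x
    simp only [S, Set.mem_union]
    split_ifs with h <;> simp [h]
  have hpos : ∀ a ∈ I, 0 < π (S a) := fun a ha =>
    (pos_iff_ne_zero.2 (Finset.mem_filter.1 ha).2).trans_le (measure_mono Set.subset_union_left)
  refine ⟨I.image S, ⟨⟨?_, fun x => ?_⟩, ?_, ?_⟩, ?_, ?_⟩
  · intro h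
    obtain ⟨a, ha, h0⟩ := Finset.mem_image.1 (Finset.mem_coe.1 h)
    have := hpos a ha
    simp [h0] at this
  · have huniq : ∀ a ∈ I, ∀ a' ∈ I, x ∈ S a → x ∈ S a' → a = a' := by
      intro a ha a' ha' h h'
      rw [hS] at h h'
      have hEN : ∀ a ∈ I, x ∈ E a → x ∉ N := fun a ha hx => by
        simp only [N, Set.notMem_compl_iff]
        exact Set.mem_biUnion (x := a) ha hx
      rcases h with h | h <;> rcases h' with h' | h'
      · by_contra hne
        exact (Set.disjoint_left.1 (hdisj hne)) h h'
      · exact absurd h'.2 (hEN a ha h)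
      · exact absurd h.2 (hEN a' ha' h')
      · rw [h.1, h'.1]
    obtain ⟨a, ha, hx⟩ : ∃ a ∈ I, x ∈ S a := by
      by_cases hx : x ∈ N
      · exact ⟨a₀, ha₀, (hS _ _).2 (Or.inr ⟨rfl, hx⟩)⟩
      · simp only [N, Set.notMem_compl_iff, Set.mem_iUnion] at hx
        obtain ⟨a, ha, hx⟩ := hx
        exact ⟨a, ha, (hS _ _).2 (Or.inl hx)⟩
    refine ⟨S a, ⟨Finset.mem_coe.2 (Finset.mem_image_of_mem S ha), hx⟩, ?_⟩
    rintro T ⟨hT, hxT⟩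
    obtain ⟨a', ha', rfl⟩ := Finset.mem_image.1 (Finset.mem_coe.1 hT)
    rw [huniq a ha a' ha' hx hxT]
  · intro T hT
    obtain ⟨a, -, rfl⟩ := Finset.mem_image.1 hT
    refine (hE a).union ?_
    split_ifs
    exacts [hNm, MeasurableSet.empty]
  · intro T hT
    obtain ⟨a, ha, rfl⟩ := Finset.mem_image.1 hT
    exact hpos a ha
  · exact Finset.card_image_le.trans ((Finset.card_le_univ _).trans (by simp))
  · intro T hT
    obtain ⟨a, ha, rfl⟩ := Finset.mem_image.1 hT
    refine ⟨a, ?_⟩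
    filter_upwards [hN] with x hx hxS
    rcases (hS a x).1 hxS with h | h
    · exact disjointed_subset C a h
    · exact absurd h.2 hx

end Partition

/-! ### Averaging error controlled by row variation -/

namespace Graphon

variable {J : Type*} [MeasurableSpace J] {π : Measure J}

/-- The deviation from the mean is the mean of the differences `w z - w z'`. -/
theorem lintegral_enorm_sub_average_le {α : Type*} [MeasurableSpace α] {ρ : Measure α}
    [IsFiniteMeasure ρ] {w : α → ℝ} (hw : Integrable w ρ) (hρ : ρ.real Set.univ ≠ 0) :
    ∫⁻ z, ‖w z - (ρ.real Set.univ)⁻¹ * ∫ z', w z' ∂ρ‖ₑ ∂ρ ≤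
      (ρ Set.univ)⁻¹ * ∫⁻ z, ∫⁻ z', ‖w z - w z'‖ₑ ∂ρ ∂ρ := by
  have h0 : ρ Set.univ ≠ 0 := fun h => hρ (by simp [Measure.real, h])
  rw [← lintegral_const_mul' _ _ (ENNReal.inv_ne_top.2 h0)]
  refine lintegral_mono fun z => ?_
  have h1 : w z - (ρ.real Set.univ)⁻¹ * ∫ z', w z' ∂ρ
      = (ρ.real Set.univ)⁻¹ * ∫ z', (w z - w z') ∂ρ := by
    rw [integral_sub (integrable_const _) hw, integral_const, smul_eq_mul]
    field_simp
  have h2 : ‖(ρ.real Set.univ)⁻¹‖ₑ = (ρ Set.univ)⁻¹ := by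
    rw [Real.enorm_of_nonneg (by positivity),
      ENNReal.ofReal_inv_of_pos (lt_of_le_of_ne measureReal_nonneg hρ.symm), ofReal_measureReal]
  rw [h1, enorm_mul, h2]
  gcongr
  exact enorm_integral_le_lintegral_enorm _

theorem lintegral_lintegral_prod_fst {μ ν : Measure J} [SFinite μ] [SFinite ν]
    {G : (J × J) × J → ℝ≥0∞} (hG : Measurable G) :
    ∫⁻ z, ∫⁻ z', G ((z.1, z'.1), z.2) ∂(μ.prod ν) ∂(μ.prod ν) =
      ν Set.univ * ∫⁻ x, ∫⁻ x', ∫⁻ y, G ((x, x'), y) ∂ν ∂μ ∂μ := by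
  have h1 : ∀ z : J × J, ∫⁻ z', G ((z.1, z'.1), z.2) ∂(μ.prod ν) =
      ν Set.univ * ∫⁻ x', G ((z.1, x'), z.2) ∂μ := by
    intro z
    have hm : Measurable fun x' => G ((z.1, x'), z.2) := hG.comp (by fun_prop)
    have hm' : Measurable fun z' : J × J => G ((z.1, z'.1), z.2) := hm.comp measurable_fst
    rw [lintegral_prod _ hm'.aemeasurable]
    simp only [lintegral_const]
    rw [lintegral_mul_const _ hm, mul_comm]
  have hm2 : Measurable fun z : J × J => ∫⁻ x', G ((z.1, x'), z.2) ∂μ :=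
    (hG.comp (f := fun p : (J × J) × J => ((p.1.1, p.2), p.1.2))
      (by fun_prop)).lintegral_prod_right'
  simp only [h1]
  rw [lintegral_const_mul _ hm2, lintegral_prod _ hm2.aemeasurable]
  congr 1
  refine lintegral_congr fun x => ?_
  exact lintegral_lintegral_swap (hG.comp (f := fun p : J × J => ((x, p.2), p.1))
    (by fun_prop)).aemeasurable

theorem lintegral_lintegral_prod_snd {μ ν : Measure J} [SFinite μ] [SFinite ν]
    {G : (J × J) × J → ℝ≥0∞} (hG : Measurable G) :
    ∫⁻ z, ∫⁻ z', G ((z.2, z'.2), z'.1) ∂(μ.prod ν) ∂(μ.prod ν) =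
      μ Set.univ * ∫⁻ y, ∫⁻ y', ∫⁻ x, G ((y, y'), x) ∂μ ∂ν ∂ν := by
  have h1 : ∀ z : J × J, ∫⁻ z', G ((z.2, z'.2), z'.1) ∂(μ.prod ν) =
      ∫⁻ y', ∫⁻ x, G ((z.2, y'), x) ∂μ ∂ν := fun z =>
    lintegral_prod_symm _ (hG.comp (f := fun p : J × J => ((z.2, p.2), p.1))
      (by fun_prop)).aemeasurable
  have hm : Measurable fun y => ∫⁻ y', ∫⁻ x, G ((y, y'), x) ∂μ ∂ν :=
    hG.lintegral_prod_right'.lintegral_prod_right'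
  have hm' : Measurable fun z : J × J => ∫⁻ y', ∫⁻ x, G ((z.2, y'), x) ∂μ ∂ν :=
    hm.comp measurable_snd
  simp only [h1]
  rw [lintegral_prod _ hm'.aemeasurable, mul_comm]
  exact lintegral_const (∫⁻ y, ∫⁻ y', ∫⁻ x, G ((y, y'), x) ∂μ ∂ν ∂ν)

theorem sum_setLIntegral_eq {P : Finset (Set J)} (hP : IsMeasurablePartition π P)
    (f : J → ℝ≥0∞) : ∑ S ∈ P, ∫⁻ x in S, f x ∂π = ∫⁻ x, f x ∂π := by
  refine (lintegral_biUnion_finset (t := id) hP.isPartition.pairwiseDisjoint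
    hP.measurableSet f).symm.trans ?_
  have : ⋃ S ∈ P, id S = Set.univ := by
    rw [← hP.isPartition.sUnion_eq_univ, Set.sUnion_eq_biUnion]; rfl
  rw [this, Measure.restrict_univ]

theorem sum_measure_eq_one [IsProbabilityMeasure π] {P : Finset (Set J)} (hP : IsMeasurablePartition π P) :
    ∑ S ∈ P, π S = 1 := by
  simpa using sum_setLIntegral_eq hP fun _ => 1

theorem sum_setLIntegral_prod_eq [SFinite π] {P : Finset (Set J)} (hP : IsMeasurablePartition π P)
    (f : J × J → ℝ≥0∞) :
    ∑ p ∈ P ×ˢ P, ∫⁻ z in p.1 ×ˢ p.2, f z ∂(π.prod π) = ∫⁻ z, f z ∂(π.prod π) := by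
  rw [← lintegral_biUnion_finset (t := fun p : Set J × Set J => p.1 ×ˢ p.2)]
  · have : ⋃ p ∈ P ×ˢ P, p.1 ×ˢ p.2 = Set.univ := by
      refine Set.eq_univ_of_forall fun z => ?_
      obtain ⟨S, ⟨hS, hzS⟩, -⟩ := hP.isPartition.2 z.1
      obtain ⟨T, ⟨hT, hzT⟩, -⟩ := hP.isPartition.2 z.2
      exact Set.mem_biUnion (x := (S, T)) (Finset.mem_product.2 ⟨hS, hT⟩) ⟨hzS, hzT⟩
    rw [this, Measure.restrict_univ]
  · rintro p hp q hq hpq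
    simp only [Finset.coe_product, Set.mem_prod] at hp hq
    rw [Function.onFun, Set.disjoint_prod]
    by_cases h1 : p.1 = q.1
    · exact Or.inr (hP.isPartition.pairwiseDisjoint hp.2 hq.2 fun h2 => hpq (Prod.ext h1 h2))
    · exact Or.inl (hP.isPartition.pairwiseDisjoint hp.1 hq.1 h1)
  · intro p hp
    rw [Finset.mem_product] at hp
    exact (hP.measurableSet _ hp.1).prod (hP.measurableSet _ hp.2)

theorem classOf_eq {P : Finset (Set J)} (hP : IsMeasurablePartition π P) {S : Set J} (hS : S ∈ P)
    {x : J} (hx : x ∈ S) : classOf P x = S := by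
  have : {T : Set J | T ∈ P ∧ x ∈ T} = {S} := by
    ext T
    constructor
    · rintro ⟨hT, hxT⟩
      exact (hP.isPartition.2 x).unique ⟨hT, hxT⟩ ⟨hS, hx⟩
    · rintro rfl
      exact ⟨hS, hx⟩
  rw [classOf, this, Set.sUnion_singleton]

variable (W : Graphon J)

/-- The variation of the rows of `W` over `S`, seen from `T`. -/
noncomputable def rowVariation (π : Measure J) (S T : Set J) : ℝ≥0∞ :=
  ∫⁻ x in S, ∫⁻ x' in S, ∫⁻ y in T, ‖W.toFun x y - W.toFun x' y‖ₑ ∂π ∂π ∂π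

theorem measurable_enorm_sub_rows :
    Measurable fun z : (J × J) × J => ‖W.toFun z.1.1 z.2 - W.toFun z.1.2 z.2‖ₑ :=
  ((W.measurable_uncurry.comp (f := fun z : (J × J) × J => (z.1.1, z.2)) (by fun_prop)).sub
    (W.measurable_uncurry.comp (f := fun z : (J × J) × J => (z.1.2, z.2)) (by fun_prop))).enorm

theorem integrable_uncurry (ρ : Measure (J × J)) [IsFiniteMeasure ρ] :
    Integrable (fun z : J × J => W.toFun z.1 z.2) ρ :=
  Integrable.of_bound W.measurable_uncurry.aestronglyMeasurable 1
    (Filter.Eventually.of_forall fun z => by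
      rw [Real.norm_of_nonneg (W.mem_Icc _ _).1]
      exact (W.mem_Icc _ _).2)

theorem sum_rowVariation [SFinite π] {P : Finset (Set J)} (hP : IsMeasurablePartition π P) (S : Set J) :
    ∑ T ∈ P, W.rowVariation π S T = W.rowVariation π S Set.univ := by
  have hm : ∀ T, Measurable fun p : J × J =>
      ∫⁻ y in T, ‖W.toFun p.1 y - W.toFun p.2 y‖ₑ ∂π := fun T =>
    W.measurable_enorm_sub_rows.lintegral_prod_right'
  simp only [rowVariation]
  rw [← lintegral_finsetSum _ fun T _ => (hm T).lintegral_prod_right']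
  refine lintegral_congr fun x => ?_
  have hmx : ∀ T, Measurable fun x' =>
      ∫⁻ y in T, ‖W.toFun x y - W.toFun x' y‖ₑ ∂π := fun T =>
    (hm T).comp (measurable_prodMk_left (x := x))
  rw [← lintegral_finsetSum _ fun T _ => hmx T]
  refine lintegral_congr fun x' => ?_
  rw [sum_setLIntegral_eq hP, Measure.restrict_univ]

/-- Two points of the block are compared by moving one coordinate at a time. In each term one of the
four variables is idle and integrates to a factor cancelling part of the normalisation; symmetry of
`W` turns the column term into a row variation. -/
theorem setLIntegral_sub_average_le [IsProbabilityMeasure π] {S T : Set J} (hS : 0 < π S) (hT : 0 < π T) :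
    ∫⁻ z in S ×ˢ T, ‖W.toFun z.1 z.2 - (π.real S * π.real T)⁻¹ *
        ∫ z' in S ×ˢ T, W.toFun z'.1 z'.2 ∂(π.prod π)‖ₑ ∂(π.prod π) ≤
      (π S)⁻¹ * W.rowVariation π S T + (π T)⁻¹ * W.rowVariation π T S := by
  have hmass : ((π.prod π).restrict (S ×ˢ T)) Set.univ = π S * π T := by simp
  have hreal : ((π.prod π).restrict (S ×ˢ T)).real Set.univ = π.real S * π.real T := by
    simp [Measure.real]
  have hS' : 0 < π.real S := ENNReal.toReal_pos hS.ne' (measure_ne_top _ _)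
  have hT' : 0 < π.real T := ENNReal.toReal_pos hT.ne' (measure_ne_top _ _)
  have h1 := lintegral_enorm_sub_average_le (ρ := (π.prod π).restrict (S ×ˢ T))
    (W.integrable_uncurry _) (by rw [hreal]; positivity)
  rw [hmass, hreal] at h1
  refine h1.trans ?_
  have hG := W.measurable_enorm_sub_rows
  have hA : ∫⁻ z in S ×ˢ T, ∫⁻ z' in S ×ˢ T, ‖W.toFun z.1 z.2 - W.toFun z'.1 z.2‖ₑ
      ∂(π.prod π) ∂(π.prod π) = π T * W.rowVariation π S T := by
    simp only [← Measure.prod_restrict]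
    rw [lintegral_lintegral_prod_fst hG, Measure.restrict_apply_univ]
    rfl
  have hB : ∫⁻ z in S ×ˢ T, ∫⁻ z' in S ×ˢ T, ‖W.toFun z.2 z'.1 - W.toFun z'.2 z'.1‖ₑ
      ∂(π.prod π) ∂(π.prod π) = π S * W.rowVariation π T S := by
    simp only [← Measure.prod_restrict]
    rw [lintegral_lintegral_prod_snd hG, Measure.restrict_apply_univ]
    rfl
  have hAB : ∫⁻ z in S ×ˢ T, ∫⁻ z' in S ×ˢ T, ‖W.toFun z.1 z.2 - W.toFun z'.1 z'.2‖ₑ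
      ∂(π.prod π) ∂(π.prod π) ≤ π T * W.rowVariation π S T + π S * W.rowVariation π T S := by
    have hmA : Measurable fun p : (J × J) × (J × J) =>
        ‖W.toFun p.1.1 p.1.2 - W.toFun p.2.1 p.1.2‖ₑ :=
      hG.comp (f := fun p : (J × J) × (J × J) => ((p.1.1, p.2.1), p.1.2)) (by fun_prop)
    rw [← hA, ← hB, ← lintegral_add_left hmA.lintegral_prod_right']
    refine lintegral_mono fun z => ?_
    have hmz : Measurable fun z' : J × J => ‖W.toFun z.1 z.2 - W.toFun z'.1 z.2‖ₑ :=
      hmA.comp (measurable_prodMk_left (x := z))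
    rw [← lintegral_add_left hmz]
    refine lintegral_mono fun z' => ?_
    rw [W.symm z.2 z'.1, W.symm z'.2 z'.1, ← sub_add_sub_cancel _ (W.toFun z'.1 z.2)]
    exact enorm_add_le _ _
  calc (π S * π T)⁻¹ * _ ≤ (π S * π T)⁻¹ *
        (π T * W.rowVariation π S T + π S * W.rowVariation π T S) := by gcongr
    _ = _ := by
      have hSt := measure_ne_top π S
      have hTt := measure_ne_top π T
      rw [ENNReal.mul_inv (Or.inl hS.ne') (Or.inl hSt), mul_add]
      congr 1
      · rw [mul_assoc, ← mul_assoc (π T)⁻¹, ENNReal.inv_mul_cancel hT.ne' hTt, one_mul]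
      · rw [mul_comm (π S)⁻¹, mul_assoc, ← mul_assoc (π S)⁻¹,
          ENNReal.inv_mul_cancel hS.ne' hSt, one_mul]

theorem rowVariation_univ_le {S : Set J} {η : ℝ≥0∞} (hSm : MeasurableSet S)
    (h : ∀ᵐ x ∂π, x ∈ S → ∀ᵐ x' ∂π, x' ∈ S →
      ∫⁻ y, ‖W.toFun x y - W.toFun x' y‖ₑ ∂π ≤ η) :
    W.rowVariation π S Set.univ ≤ η * π S * π S := by
  simp only [rowVariation, Measure.restrict_univ]
  have h1 : ∀ᵐ x ∂π, x ∈ S →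
      ∫⁻ x' in S, ∫⁻ y, ‖W.toFun x y - W.toFun x' y‖ₑ ∂π ∂π ≤ η * π S := by
    filter_upwards [h] with x hx hxS
    refine (lintegral_mono_ae ((ae_restrict_iff' hSm).2 (hx hxS))).trans ?_
    simp
  refine (lintegral_mono_ae ((ae_restrict_iff' hSm).2 h1)).trans ?_
  simp

/-- Summing a block's row term over all `T` gives the variation over the whole space, at most
η·π(S)² per class; after division by π(S) the sum over `S` is at most η. The column terms are the
same sum with `S` and `T` exchanged, whence 2η. -/
theorem integral_abs_sub_stepAverage_le [IsProbabilityMeasure π] {P : Finset (Set J)} (hP : IsMeasurablePartition π P)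
    {η : ℝ} (hη : 0 ≤ η)
    (h : ∀ S ∈ P, ∀ᵐ x ∂π, x ∈ S → ∀ᵐ x' ∂π, x' ∈ S →
      ∫⁻ y, ‖W.toFun x y - W.toFun x' y‖ₑ ∂π ≤ ENNReal.ofReal η) :
    ∫ z : J × J, |W.toFun z.1 z.2 - W.stepAverage π P z.1 z.2| ∂(π.prod π) ≤ 2 * η := by
  have hrow : ∑ p ∈ P ×ˢ P, (π p.1)⁻¹ * W.rowVariation π p.1 p.2 ≤ ENNReal.ofReal η := by
    rw [Finset.sum_product]
    calc ∑ S ∈ P, ∑ T ∈ P, (π S)⁻¹ * W.rowVariation π S T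
        ≤ ∑ S ∈ P, ENNReal.ofReal η * π S := by
          refine Finset.sum_le_sum fun S hS => ?_
          rw [← Finset.mul_sum, W.sum_rowVariation hP]
          calc (π S)⁻¹ * W.rowVariation π S Set.univ
              ≤ (π S)⁻¹ * (ENNReal.ofReal η * π S * π S) := by
                gcongr
                exact W.rowVariation_univ_le (hP.measurableSet S hS) (h S hS)
            _ = ENNReal.ofReal η * π S := by
                rw [mul_comm, mul_assoc, ENNReal.mul_inv_cancel (hP.measure_pos S hS).ne'
                  (measure_ne_top _ _), mul_one]
      _ = ENNReal.ofReal η := by rw [← Finset.mul_sum, sum_measure_eq_one hP, mul_one]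
  have hcol : ∑ p ∈ P ×ˢ P, (π p.2)⁻¹ * W.rowVariation π p.2 p.1 ≤ ENNReal.ofReal η := by
    rw [Finset.sum_product, Finset.sum_comm]
    rwa [Finset.sum_product] at hrow
  have hmain : ∫⁻ z : J × J, ‖W.toFun z.1 z.2 - W.stepAverage π P z.1 z.2‖ₑ ∂(π.prod π) ≤
      ENNReal.ofReal (2 * η) := by
    rw [← sum_setLIntegral_prod_eq hP]
    calc _ ≤ ∑ p ∈ P ×ˢ P, ((π p.1)⁻¹ * W.rowVariation π p.1 p.2 +
          (π p.2)⁻¹ * W.rowVariation π p.2 p.1) := by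
          refine Finset.sum_le_sum fun p hp => ?_
          rw [Finset.mem_product] at hp
          refine le_trans (le_of_eq ?_) (W.setLIntegral_sub_average_le
            (hP.measure_pos _ hp.1) (hP.measure_pos _ hp.2))
          refine setLIntegral_congr_fun
            ((hP.measurableSet _ hp.1).prod (hP.measurableSet _ hp.2)) fun z hz => ?_
          simp only [stepAverage, classOf_eq hP hp.1 hz.1, classOf_eq hP hp.2 hz.2]
      _ ≤ ENNReal.ofReal η + ENNReal.ofReal η := by
          rw [Finset.sum_add_distrib]
          exact add_le_add hrow hcol
      _ = ENNReal.ofReal (2 * η) := by rw [two_mul, ENNReal.ofReal_add hη hη]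
  refine (Real.le_norm_self _).trans ((norm_integral_le_lintegral_norm _).trans ?_)
  refine ENNReal.toReal_le_of_le_ofReal (by positivity) (le_trans (le_of_eq ?_) hmain)
  refine lintegral_congr fun z => ?_
  rw [← ofReal_norm, norm_abs_eq_norm]

end Graphon

/-! ### Assembly for graphons excluding `F` -/

namespace Graphon

variable {J : Type*} [MeasurableSpace J] {π : Measure J} [IsProbabilityMeasure π] (W : Graphon J)
  {U₁ U₂ : Type*} [Fintype U₁] [Fintype U₂] {F : Bigraph U₁ U₂}

theorem ae_ae_eq_zero_or_one_of_excludesInduced {W : Graphon J} (h : W.ExcludesInduced π F) :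
    ∀ᵐ x ∂π, ∀ᵐ y ∂π, W.toFun x y = 0 ∨ W.toFun x y = 1 := by
  have hm := W.measurable_uncurry
  refine ae_ae_of_ae_ae_pi_exists (U₁ := U₁) (U₂ := U₂) ?_ ?_
  · exact (hm (measurableSet_singleton 0)).union (hm (measurableSet_singleton 1))
  · filter_upwards [W.ae_ae_indWeight_eq_zero F π π h] with x hx
    filter_upwards [hx] with y hy
    by_contra! hne
    refine (W.indWeight_pos F x y (fun i j _ => ?_) fun i j _ => ?_).ne' hy
    · exact lt_of_le_of_ne (W.mem_Icc _ _).1 (hne i j).1.symm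
    · exact lt_of_le_of_ne (W.mem_Icc _ _).2 (hne i j).2

theorem ae_ae_not_pattern_of_excludesInduced {W : Graphon J} (h : W.ExcludesInduced π F) :
    ∀ᵐ x : U₁ → J ∂(Measure.pi fun _ => π), ∀ᵐ y : U₂ → J ∂(Measure.pi fun _ => π),
      ¬ ∀ i j, 1 / 2 < W.toFun (x i) (y j) ↔ (i, j) ∈ F.edges := by
  filter_upwards [W.ae_ae_indWeight_eq_zero F π π h] with x hx
  filter_upwards [hx] with y hy hpat
  refine (W.indWeight_pos F x y (fun i j hij => ?_) fun i j hij => ?_).ne' hy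
  · linarith [(hpat i j).2 hij]
  · linarith [not_lt.1 fun h' => hij ((hpat i j).1 h')]

theorem measurableSet_half_lt_row (x : J) : MeasurableSet {y | 1 / 2 < W.toFun x y} :=
  measurableSet_lt measurable_const (W.measurable_uncurry.of_uncurry_left (x := x))

theorem measurable_nbhdDist (x₀ : J) :
    Measurable fun x => nbhdDist π (fun x y => 1 / 2 < W.toFun x y) x x₀ := by
  have h : MeasurableSet {z : J × J | ¬ (1 / 2 < W.toFun z.1 z.2 ↔ 1 / 2 < W.toFun x₀ z.2)} :=
    ((measurableSet_lt measurable_const W.measurable_uncurry).iff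
      ((W.measurableSet_half_lt_row x₀).preimage measurable_snd)).compl
  exact (measurable_measure_prodMk_left h).ennreal_toReal

/-- For 0–1 valued rows the threshold at 1/2 loses nothing, so the rows can differ only where one of
them disagrees with the thresholded row of `x₀`. That row itself need not be 0–1 valued. -/
theorem lintegral_enorm_sub_le {x x' x₀ : J} {δ : ℝ}
    (hx : ∀ᵐ y ∂π, W.toFun x y = 0 ∨ W.toFun x y = 1)
    (hx' : ∀ᵐ y ∂π, W.toFun x' y = 0 ∨ W.toFun x' y = 1)
    (hd : nbhdDist π (fun x y => 1 / 2 < W.toFun x y) x x₀ ≤ δ)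
    (hd' : nbhdDist π (fun x y => 1 / 2 < W.toFun x y) x' x₀ ≤ δ) :
    ∫⁻ y, ‖W.toFun x y - W.toFun x' y‖ₑ ∂π ≤ ENNReal.ofReal (2 * δ) := by
  classical
  let B : J → Set J := fun x => {y | ¬ (1 / 2 < W.toFun x y ↔ 1 / 2 < W.toFun x₀ y)}
  have hB : ∀ x, MeasurableSet (B x) := fun x =>
    ((W.measurableSet_half_lt_row x).iff (W.measurableSet_half_lt_row x₀)).compl
  have hle : ∀ x, nbhdDist π (fun x y => 1 / 2 < W.toFun x y) x x₀ ≤ δ →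
      π (B x) ≤ ENNReal.ofReal δ := fun x h => by
    rw [← ofReal_measureReal]
    exact ENNReal.ofReal_le_ofReal h
  have hδ : 0 ≤ δ := measureReal_nonneg.trans hd
  have hpt : ∀ᵐ y ∂π, ‖W.toFun x y - W.toFun x' y‖ₑ ≤ (B x ∪ B x').indicator 1 y := by
    filter_upwards [hx, hx'] with y hy hy'
    by_cases hmem : y ∈ B x ∪ B x'
    · rw [Set.indicator_of_mem hmem]
      rcases hy with hy | hy <;> rcases hy' with hy' | hy' <;> simp [hy, hy']
    · have : W.toFun x y = W.toFun x' y := by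
        simp only [B, Set.mem_union, Set.mem_ofPred_eq, not_or, not_not] at hmem
        have h2 := hmem.1.trans hmem.2.symm
        rcases hy with hy | hy <;> rcases hy' with hy' | hy' <;> rw [hy, hy'] at h2 ⊢ <;>
          norm_num at h2
      simp [this]
  calc ∫⁻ y, ‖W.toFun x y - W.toFun x' y‖ₑ ∂π ≤ ∫⁻ y, (B x ∪ B x').indicator 1 y ∂π :=
        lintegral_mono_ae hpt
    _ = π (B x ∪ B x') := lintegral_indicator_one ((hB x).union (hB x'))
    _ ≤ π (B x) + π (B x') := measure_union_le _ _
    _ ≤ ENNReal.ofReal δ + ENNReal.ofReal δ := add_le_add (hle x hd) (hle x' hd')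
    _ = ENNReal.ofReal (2 * δ) := by rw [two_mul, ENNReal.ofReal_add hδ hδ]

theorem exists_isUltraStrongPartition {W : Graphon J} (h : W.ExcludesInduced π F) {δ : ℝ}
    (hδ0 : 0 < δ) (hδ : δ ≤ 1) :
    ∃ P : Finset (Set J), W.IsUltraStrongPartition π P (4 * δ) ∧
      (P.card : ℝ) ≤ packingConst (Fintype.card U₁ + Fintype.card U₂) *
        (δ⁻¹) ^ (2 * (Fintype.card U₁ + Fintype.card U₂)) := by
  obtain ⟨m, hm, c, hc⟩ := exists_net F W.measurableSet_half_lt_row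
    (ae_ae_not_pattern_of_excludesInduced h) hδ0 hδ
  obtain ⟨P, hP, hcard, hsub⟩ := exists_partition_of_ae_cover _
    (fun a => measurableSet_le (W.measurable_nbhdDist (π := π) (c a)) measurable_const) hc
  refine ⟨P, ⟨hP, ?_⟩, le_trans (by exact_mod_cast hcard) hm⟩
  refine (W.integral_abs_sub_stepAverage_le hP (η := 2 * δ) (by positivity) ?_).trans
    (le_of_eq (by ring))
  intro S hS
  obtain ⟨a, ha⟩ := hsub S hS
  have h01 := ae_ae_eq_zero_or_one_of_excludesInduced h
  filter_upwards [ha, h01] with x hxa hx hxS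
  filter_upwards [ha, h01] with x' hxa' hx' hxS'
  exact W.lintegral_enorm_sub_le hx hx' (hxa hxS) (hxa' hxS')

end Graphon

theorem theorem5p7 {U₁ U₂ : Type*} [Fintype U₁] [Fintype U₂] (F : Bigraph U₁ U₂) :
    ∃ c : ℝ, 0 < c ∧
      ∀ (J : Type*) [MeasurableSpace J] (π : Measure J) [IsProbabilityMeasure π] (W : Graphon J),
        W.ExcludesInduced π F →
        ∀ ε : ℝ, 0 < ε → ε < 1 →
          ∃ P : Finset (Set J), W.IsUltraStrongPartition π P ε ∧
            (P.card : ℝ) ≤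
              c * ε ^ (-(10 * ((Fintype.card U₁ + Fintype.card U₂ : ℕ) : ℤ) ^ 2)) := by
  set D := Fintype.card U₁ + Fintype.card U₂ with hD
  have hK : 0 ≤ packingConst D := sq_nonneg _
  -- The factor 4^(2D) comes from δ = ε/4; the added 1 keeps the constant positive when D = 0, where
  -- `packingConst` vanishes.
  refine ⟨packingConst D * 4 ^ (2 * D) + 1, by positivity, ?_⟩
  intro J _ π _ W hW ε hε hε1
  obtain ⟨P, hP, hcard⟩ := Graphon.exists_isUltraStrongPartition hW (δ := ε / 4)
    (by positivity) (by linarith)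
  rw [show 4 * (ε / 4) = ε by ring] at hP
  refine ⟨P, hP, hcard.trans ?_⟩
  rw [← hD]
  have hpow : (ε⁻¹) ^ (2 * D) ≤ ε ^ (-(10 * (D : ℤ) ^ 2)) := by
    have h1 : ε ^ (-(10 * (D : ℤ) ^ 2)) = (ε⁻¹) ^ (10 * D ^ 2) := by
      rw [zpow_neg, ← inv_zpow, ← zpow_natCast]
      push_cast
      rfl
    rw [h1]
    refine pow_le_pow_right₀ ((one_le_inv₀ hε).2 hε1.le) ?_
    nlinarith [Nat.le_self_pow two_ne_zero D]
  calc packingConst D * ((ε / 4)⁻¹) ^ (2 * D)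
      = packingConst D * 4 ^ (2 * D) * (ε⁻¹) ^ (2 * D) := by
        rw [inv_div, div_eq_mul_inv, mul_pow, mul_assoc]
    _ ≤ (packingConst D * 4 ^ (2 * D) + 1) * ε ^ (-(10 * (D : ℤ) ^ 2)) := by
        gcongr
        linarith
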